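/- A Dyck word of semilength $n$ is a word of length $2n$ consisting of $n$ letters $x$ and $n$ letters $y$ such that every initial segment contains at least as many $x$'s as $y$'s. Let $\mathcal{D}_n$ be the set of Dyck words of semilength $n$. For $D\in\mathcal{D}_n$ and $1\le i\le n-1$, let $r_i(D)$ be the number of $y$'s between the $i$-th $x$ and the $(i+1)$-st $x$ in $D$, and let $s_i(D)$ be the number of $x$'s between the $i$-th $y$ and the $(i+1)$-st $y$ in $D$. Then for all $n\ge 1$, $$\sum_{D\in\mathcal{D}_n}\ \prod_{i=1}^{n-1}\binom{r_i(D)+s_i(D)}{r_i(D)}=\frac{1}{2n+1}\binom{3n}{n}.$$ -/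

import Mathlib

/-- The letter at (0-based) position `p` of the word `w` is the `i`-th occurrence (`i = 1, 2, …`)
of the letter `a` in `w`. -/
def IsNthOccurrence (w : List DyckStep) (a : DyckStep) (i p : ℕ) : Prop :=
  w[p]? = some a ∧ (w.take p).count a + 1 = i

instance instDecidableIsNthOccurrence (w : List DyckStep) (a : DyckStep) (i p : ℕ) :
    Decidable (IsNthOccurrence w a i p) :=
  inferInstanceAs (Decidable (_ ∧ _))

/-- The number of letters `b` of the word `w` that lie strictly between the `i`-th and the
`(i + 1)`-st occurrence of the letter `a`. -/
def countBetween (w : List DyckStep) (a b : DyckStep) (i : ℕ) : ℕ :=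
  ((Finset.range w.length).filter fun j =>
    w[j]? = some b ∧
      (∃ p < j, IsNthOccurrence w a i p) ∧
      (∃ q < w.length, j < q ∧ IsNthOccurrence w a (i + 1) q)).card

/-- `r_i(D)`: the number of down steps between the `i`-th and the `(i + 1)`-st up step. -/
def DyckWord.rStat (D : DyckWord) (i : ℕ) : ℕ :=
  countBetween D.toList DyckStep.U DyckStep.D i

/-- `s_i(D)`: the number of up steps between the `i`-th and the `(i + 1)`-st down step. -/
def DyckWord.sStat (D : DyckWord) (i : ℕ) : ℕ :=
  countBetween D.toList DyckStep.D DyckStep.U i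

/-! Let a queue write a word and read the same word, starting and ending empty, where reading the
i-th `U` coincides with writing the i-th `D`. Between consecutive such moves, reads of `D` and
writes of `U` interleave freely, which gives the binomial factors; never reading from an empty queue
amounts to the Dyck condition (`queueRuns_eq_ite`, `readWriteRuns_eq_prod`). So the sum counts all
runs over all words. Now weigh `U` by 2 and `D` by 1. Writing `U` raises the weight of the queue by
2; each read move lowers it by 1, and the front letter decides which one it is. Hence runs
correspond to paths with steps +2 and -1 (`sum_queueRuns`), counted by `ballotCount_zero_left`. -/

/-! ### Ballot paths with steps +2 and -1 -/

/-- The number of words with `k` letters "push" and `p + 2 * k` letters "pop" such that a counter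
which starts at `p`, gains `2` at each push and loses `1` at each pop never becomes negative. -/
def ballotCount : ℕ → ℕ → ℕ
  | 0, 0 => 1
  | p + 1, 0 => ballotCount p 0
  | 0, k + 1 => ballotCount 2 k
  | p + 1, k + 1 => ballotCount (p + 3) k + ballotCount p (k + 1)
termination_by p k => p + 3 * k

theorem ballotCount_zero_right (p : ℕ) : ballotCount p 0 = 1 := by
  induction p with
  | zero => rw [ballotCount]
  | succ p ih => rw [ballotCount, ih]

/-- Both sides obey Pascal's recurrence in the path length; subtraction is avoided by moving the
correction term to the left. -/
theorem ballotCount_add_two_mul_choose (k p : ℕ) :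
    ballotCount p (k + 1) + 2 * (p + 3 * k + 3).choose k = (p + 3 * k + 3).choose (k + 1) := by
  induction k generalizing p with
  | zero =>
    induction p with
    | zero => simp [ballotCount, ballotCount_zero_right]
    | succ p ih =>
      simp only [ballotCount, ballotCount_zero_right] at ih ⊢
      simp at ih ⊢
      omega
  | succ k ihk =>
    induction p with
    | zero =>
      rw [ballotCount]
      have h := ihk 2
      have e : 0 + 3 * (k + 1) + 3 = (2 + 3 * k + 3) + 1 := by ring
      rw [e, Nat.choose_succ_succ' _ k, Nat.choose_succ_succ' _ (k + 1)]
      -- The closed form vanishes at p = -1, which matches the forced push at p = 0.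
      have h2 := Nat.choose_succ_right_eq (2 + 3 * k + 3) (k + 1)
      have e2 : 2 + 3 * k + 3 - (k + 1) = 2 * (k + 1 + 1) := by omega
      rw [e2, ← mul_assoc] at h2
      have h3 := Nat.eq_of_mul_eq_mul_right (Nat.succ_pos _) h2
      omega
    | succ p ihp =>
      rw [ballotCount]
      have h := ihk (p + 3)
      have e : p + 1 + 3 * (k + 1) + 3 = (p + 3 * (k + 1) + 3) + 1 := by ring
      have e' : p + 3 + 3 * k + 3 = p + 3 * (k + 1) + 3 := by ring
      rw [e'] at h
      rw [e, Nat.choose_succ_succ' _ k, Nat.choose_succ_succ' _ (k + 1)]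
      omega

theorem ballotCount_zero_left (n : ℕ) :
    (2 * n + 1) * ballotCount 0 n = (3 * n).choose n := by
  cases n with
  | zero => simp [ballotCount]
  | succ k =>
    have h := ballotCount_add_two_mul_choose k 0
    have h2 := Nat.choose_succ_right_eq (3 * k + 3) k
    have e2 : 3 * k + 3 - k = 2 * k + 3 := by omega
    rw [e2] at h2
    rw [zero_add] at h
    have e : 3 * (k + 1) = 3 * k + 3 := by ring
    rw [e]
    zify at h h2 ⊢
    have h4 : (ballotCount 0 (k + 1) : ℤ)
        = (3 * k + 3).choose (k + 1) - 2 * (3 * k + 3).choose k := by linarith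
    rw [h4]
    linear_combination (2 : ℤ) * h2

/-! ### Runs of the queue as products of binomials -/

/-- The number of ways to run a queue which currently holds the word `v` so that it becomes empty
after the word `t` has been written to it. The admissible moves are: write `U`; read `D`; read `U`
and write `D`. -/
def queueRuns : List DyckStep → List DyckStep → ℕ
  | [], [] => 1
  | [], .D :: _ => 0
  | [], .U :: t => queueRuns [.U] t
  | .U :: _, [] => 0
  | .U :: v, .U :: t => queueRuns (.U :: v ++ [.U]) t
  | .U :: v, .D :: t => queueRuns (v ++ [.D]) t
  | .D :: v, [] => queueRuns v []
  | .D :: v, .U :: t => queueRuns (.D :: v ++ [.U]) t + queueRuns v (.U :: t)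
  | .D :: v, .D :: t => queueRuns v (.D :: t)
termination_by v t => v.length + 2 * t.length
decreasing_by all_goals simp <;> omega

/-- The number of ways to read the word `l` while writing the word `m`, where the admissible moves
are those of `queueRuns` and the two words are treated as independent. -/
def readWriteRuns : List DyckStep → List DyckStep → ℕ
  | [], [] => 1
  | [], .D :: _ => 0
  | [], .U :: m => readWriteRuns [] m
  | .U :: _, [] => 0
  | .U :: l, .U :: m => readWriteRuns (.U :: l) m
  | .U :: l, .D :: m => readWriteRuns l m
  | .D :: l, [] => readWriteRuns l []
  | .D :: l, .U :: m => readWriteRuns (.D :: l) m + readWriteRuns l (.U :: m)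
  | .D :: l, .D :: m => readWriteRuns l (.D :: m)
termination_by l m => l.length + m.length

/-- The number of letters other than `a` of the word `w` that are preceded by exactly `i` letters
`a`. -/
def gapLength (a : DyckStep) : List DyckStep → ℕ → ℕ
  | [], _ => 0
  | c :: w, 0 => if c = a then 0 else gapLength a w 0 + 1
  | c :: w, i + 1 => if c = a then gapLength a w i else gapLength a w (i + 1)

theorem gapLength_cons_self_zero (a : DyckStep) (w : List DyckStep) :
    gapLength a (a :: w) 0 = 0 := by simp [gapLength]

theorem gapLength_cons_of_ne_succ {a c : DyckStep} (h : c ≠ a) (w : List DyckStep) (i : ℕ) :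
    gapLength a (c :: w) (i + 1) = gapLength a w (i + 1) := by simp [gapLength, h]

theorem gapLength_cons_of_ne_zero {a c : DyckStep} (h : c ≠ a) (w : List DyckStep) :
    gapLength a (c :: w) 0 = gapLength a w 0 + 1 := by simp [gapLength, h]

theorem gapLength_append_self (a : DyckStep) (w : List DyckStep) :
    gapLength a (w ++ [a]) (w.count a + 1) = 0 := by
  induction w with
  | nil => simp [gapLength]
  | cons c w ih =>
    by_cases h : c = a
    · subst h; simpa [gapLength] using ih
    · simpa [gapLength, h] using ih

/-- The synchronised moves cut a run into blocks; block i shuffles the i-th gap of `D`s in `l` with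
the i-th gap of `U`s in `m`. -/
theorem readWriteRuns_eq_prod (l m : List DyckStep) (h : l.count .U = m.count .D) :
    readWriteRuns l m = ∏ i ∈ Finset.range (l.count .U + 1),
      (gapLength .U l i + gapLength .D m i).choose (gapLength .U l i) := by
  fun_induction readWriteRuns l m with
  | case1 => simp [gapLength]
  | case2 => simp at h
  | case3 m ih =>
    rw [ih (by simpa using h)]
    simp [gapLength]
  | case4 => simp at h
  | case5 l m ih =>
    rw [ih (by simpa using h), Finset.prod_range_succ', Finset.prod_range_succ' _ (List.count _ _)]
    simp [gapLength]
  | case6 l m ih =>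
    rw [ih (by simpa using h), List.count_cons_self, Finset.prod_range_succ' _ (_ + 1)]
    simp [gapLength]
  | case7 l ih =>
    have h' : l.count .U = 0 := by simpa using h
    rw [ih (by simpa using h')]
    simp [gapLength, h']
  | case8 l m ih1 ih2 =>
    rw [ih1 (by simpa using h), ih2 (by simpa using h)]
    simp only [Finset.prod_range_succ', ne_eq, reduceCtorEq, not_false_eq_true,
      gapLength_cons_of_ne_succ, gapLength_cons_of_ne_zero, List.count_cons_of_ne]
    rw [← mul_add]
    congr 1
    rw [show gapLength .U l 0 + 1 + (gapLength .D m 0 + 1)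
      = (gapLength .U l 0 + (gapLength .D m 0 + 1)) + 1 by ring, Nat.choose_succ_succ, add_comm]
    congr 2
    ring
  | case9 l m ih =>
    rw [ih (by simpa using h)]
    simp only [Finset.prod_range_succ', ne_eq, reduceCtorEq, not_false_eq_true,
      gapLength_cons_of_ne_succ, gapLength_cons_of_ne_zero, List.count_cons_of_ne]
    simp [gapLength]

/-! ### The queue constraint as a prefix condition -/

/-- Every initial segment of `l` has at most `c` more letters `D` than letters `U`. -/
def PrefixBounded (c : ℕ) (l : List DyckStep) : Prop :=
  ∀ k, (l.take k).count .D ≤ (l.take k).count .U + c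

theorem prefixBounded_nil (c : ℕ) : PrefixBounded c [] := by simp [PrefixBounded]

theorem prefixBounded_cons_U (c : ℕ) (l : List DyckStep) :
    PrefixBounded c (.U :: l) ↔ PrefixBounded (c + 1) l := by
  constructor
  · intro h k
    have := h (k + 1)
    simp at this
    omega
  · rintro h (_ | k)
    · simp
    · have := h k
      simp
      omega

theorem prefixBounded_succ_cons_D (c : ℕ) (l : List DyckStep) :
    PrefixBounded (c + 1) (.D :: l) ↔ PrefixBounded c l := by
  constructor
  · intro h k
    have := h (k + 1)
    simp at this
    omega
  · rintro h (_ | k)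
    · simp
    · have := h k
      simp
      omega

theorem not_prefixBounded_zero_cons_D (l : List DyckStep) : ¬ PrefixBounded 0 (.D :: l) :=
  fun h => by simpa using h 1

open Classical in
-- The two recursions can differ only when the queue is empty. If the next letter is then `U`, both
-- must write it; if it is `D`, the queue is stuck and the prefix condition fails.
theorem queueRuns_eq_ite (v t : List DyckStep) :
    queueRuns v t =
      if PrefixBounded (v.count .D) (v ++ t) then readWriteRuns (v ++ t) t else 0 := by
  fun_induction queueRuns v t with
  | case1 => simp [prefixBounded_nil, readWriteRuns]
  | case2 t => simp [not_prefixBounded_zero_cons_D]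
  | case3 t ih => simp [ih, readWriteRuns]
  | case4 v => simp [readWriteRuns]
  | case5 v t ih => rw [ih]; simp [readWriteRuns]
  | case6 v t ih => simp [ih, readWriteRuns, prefixBounded_cons_U]
  | case7 v ih =>
    simp [ih, readWriteRuns, prefixBounded_succ_cons_D]
  | case8 v t ih1 ih2 =>
    simp only [ih1, ih2]
    simp [readWriteRuns, prefixBounded_succ_cons_D]
    split_ifs <;> rfl
  | case9 v t ih => simp [ih, readWriteRuns, prefixBounded_succ_cons_D]

/-! ### Summation over all words -/

/-- The words with `k` letters `U` and `j` letters `D`. -/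
def wordsWithCounts : ℕ → ℕ → Finset (List DyckStep)
  | 0, 0 => {[]}
  | k + 1, 0 => (wordsWithCounts k 0).map ⟨List.cons .U, List.cons_injective⟩
  | 0, j + 1 => (wordsWithCounts 0 j).map ⟨List.cons .D, List.cons_injective⟩
  | k + 1, j + 1 =>
    ((wordsWithCounts k (j + 1)).map ⟨List.cons .U, List.cons_injective⟩).disjUnion
      ((wordsWithCounts (k + 1) j).map ⟨List.cons .D, List.cons_injective⟩)
      (Finset.disjoint_left.2 fun l h h' => by
        simp only [Finset.mem_map, Function.Embedding.coeFn_mk] at h h'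
        obtain ⟨_, _, rfl⟩ := h
        obtain ⟨_, _, h'⟩ := h'
        simp at h')

theorem mem_wordsWithCounts (k j : ℕ) (l : List DyckStep) :
    l ∈ wordsWithCounts k j ↔ l.count .U = k ∧ l.count .D = j := by
  induction l generalizing k j with
  | nil => rcases k with _ | k <;> rcases j with _ | j <;> simp [wordsWithCounts]
  | cons c l ih =>
    rcases k with _ | k <;> rcases j with _ | j <;> cases c <;> simp [wordsWithCounts, ih]

theorem sum_queueRuns (v : List DyckStep) (k : ℕ) :
    ∑ t ∈ wordsWithCounts k (k + v.count .U), queueRuns v t =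
      ballotCount (2 * v.count .U + v.count .D) k := by
  -- This measure is the weight plus 3k; every move lowers it by exactly 1.
  induction hp : v.length + v.count .U + 3 * k using Nat.strong_induction_on generalizing v k with
  | _ p ih =>
  subst hp
  rcases v with _ | ⟨_ | _, v⟩
  · rcases k with _ | k
    · simp [wordsWithCounts, queueRuns, ballotCount]
    · have h := ih _ (by simp; omega) [.U] k rfl
      simp only [List.count_cons_self, List.count_nil, ne_eq, reduceCtorEq, not_false_eq_true,
        List.count_cons_of_ne, add_zero, zero_add, mul_one, mul_zero] at h ⊢
      rw [wordsWithCounts, Finset.sum_disjUnion, ballotCount]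
      simpa [queueRuns] using h
  · have h := ih _ (by simp) (v ++ [.D]) k rfl
    have e : 2 * (v.count .U + 1) + v.count .D = 2 * v.count .U + v.count .D + 1 + 1 := by ring
    rcases k with _ | k
    · simp [wordsWithCounts, queueRuns, e, ballotCount, ← add_assoc] at h ⊢
      exact h
    · have h' := ih _ (by simp; omega) (.U :: v ++ [.U]) k rfl
      simp only [List.count_cons_self, List.count_append, List.count_nil, ne_eq, reduceCtorEq,
        not_false_eq_true, List.count_cons_of_ne, List.cons_append, add_zero, zero_add] at h h' ⊢
      rw [← add_assoc (k + 1), wordsWithCounts, Finset.sum_disjUnion, e, ballotCount]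
      simp only [Finset.sum_map, Function.Embedding.coeFn_mk, queueRuns, List.cons_append]
      congr 1
      convert h' using 2 <;> ring_nf
  · have h := ih _ (by simp) v k rfl
    rcases k with _ | k
    · simp [ballotCount, ← add_assoc]
      rw [← h]
      refine Finset.sum_congr (by simp) fun t ht => ?_
      have := ((mem_wordsWithCounts _ _ _).1 ht).1
      rcases t with _ | ⟨_ | _, t⟩
      · simp [queueRuns]
      · simp at this
      · simp [queueRuns]
    · have h' := ih _ (by simp; omega) (.D :: v ++ [.U]) k rfl
      simp only [List.count_cons_self, List.count_append, List.count_nil, ne_eq, reduceCtorEq,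
        not_false_eq_true, List.count_cons_of_ne, List.cons_append, add_zero, zero_add] at h h' ⊢
      rw [← add_assoc, ballotCount, ← h]
      -- Reading the front `D` does not restrict the next letter written, so its terms from both
      -- halves recombine into the full sum for `v`.
      rw [show k + 1 + v.count .U = k + v.count .U + 1 by ring, wordsWithCounts,
        Finset.sum_disjUnion, Finset.sum_disjUnion]
      simp only [Finset.sum_map, Function.Embedding.coeFn_mk, queueRuns, List.cons_append,
        Finset.sum_add_distrib, add_assoc]
      congr 1
      convert h' using 2
      ring_nf

/-! ### The statistics as gap lengths -/

theorem card_filter_eq_gapLength {a b : DyckStep} (hab : b ≠ a) (w : List DyckStep) (i : ℕ) :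
    ((Finset.range w.length).filter fun j =>
      w[j]? = some b ∧ (w.take j).count a = i).card = gapLength a w i := by
  induction w generalizing i with
  | nil => simp [gapLength]
  | cons c w ih =>
    rw [List.length_cons, Finset.card_filter, Finset.sum_range_succ']
    simp only [Finset.card_filter] at ih
    by_cases h : c = a
    · subst h
      rcases i with _ | i
      · simp [gapLength, hab.symm]
      · simp [gapLength, hab.symm, ih]
    · have h' : c = b := by revert hab h; cases a <;> cases b <;> cases c <;> simp
      subst h'
      rcases i with _ | i
      · simp [gapLength, h, ih]
      · simp [gapLength, h, ih]

theorem exists_lt_isNthOccurrence (w : List DyckStep) (a : DyckStep) (i j : ℕ) :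
    (∃ p < j, IsNthOccurrence w a (i + 1) p) ↔ i + 1 ≤ (w.take j).count a := by
  induction j with
  | zero => simp
  | succ j ih =>
    rw [List.take_add_one, List.count_append]
    have h : (∃ p < j + 1, IsNthOccurrence w a (i + 1) p) ↔
        (∃ p < j, IsNthOccurrence w a (i + 1) p) ∨ IsNthOccurrence w a (i + 1) j := by
      simp only [Nat.lt_succ_iff_lt_or_eq, or_and_right, exists_or, exists_eq_left]
    rw [h, ih, IsNthOccurrence]
    rcases hj : w[j]? with _ | c
    · simp
    · by_cases hc : c = a
      · subst hc
        simp
        omega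
      · simp [hc]

theorem countBetween_eq_gapLength {a b : DyckStep} (hab : b ≠ a) (w : List DyckStep) {i : ℕ}
    (hi : 1 ≤ i) (hiw : i + 1 ≤ w.count a) : countBetween w a b i = gapLength a w i := by
  rw [← card_filter_eq_gapLength hab, countBetween]
  obtain ⟨i, rfl⟩ := Nat.exists_eq_add_of_le' hi
  congr 1
  refine Finset.filter_congr fun j hj => and_congr_right fun hb => ?_
  rw [exists_lt_isNthOccurrence]
  constructor
  · rintro ⟨h1, q, -, hjq, -, hq⟩
    have := ((List.take_prefix_take_left hjq.le : w.take j <+: w.take q).sublist).count_le a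
    omega
  · intro h
    obtain ⟨q, hq, hocc⟩ := (exists_lt_isNthOccurrence w a (i + 1) w.length).2 (by simpa using hiw)
    refine ⟨h.ge, q, hq, ?_, hocc⟩
    by_contra! hqj
    rcases hqj.eq_or_lt with rfl | hqj
    · exact hab (by simpa [hb] using hocc.1)
    · have := (exists_lt_isNthOccurrence w a (i + 1) j).1 ⟨q, hqj, hocc⟩
      omega

/-! ### Specialisation to Dyck words -/

theorem DyckWord.prod_choose_eq_readWriteRuns (D : DyckWord) {n : ℕ} (hn : 1 ≤ n)
    (hD : D.semilength = n) :
    ∏ i ∈ Finset.Icc 1 (n - 1), (D.rStat i + D.sStat i).choose (D.rStat i) =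
      readWriteRuns D.toList D.toList := by
  have hU : D.toList.count .U = n := hD
  have hD' : D.toList.count .D = n := by rw [← D.count_U_eq_count_D, hU]
  have hne : D.toList ≠ [] := by rintro h; simp [h] at hU; omega
  -- A nonempty Dyck word starts with `U` and ends with `D`, so the extra factors at i = 0 and i = n
  -- equal 1.
  have h0 : gapLength .U D.toList 0 = 0 := by
    obtain ⟨c, l, hl⟩ := List.exists_cons_of_ne_nil hne
    have := D.head_eq_U hne
    simp only [hl, List.head_cons] at this
    rw [hl, this, gapLength_cons_self_zero]
  have hlast : gapLength .D D.toList n = 0 := by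
    have hl := List.dropLast_append_getLast hne
    rw [D.getLast_eq_D hne] at hl
    rw [← hl, List.count_append] at hD'
    rw [← hl, ← hD']
    exact gapLength_append_self _ _
  obtain ⟨n, rfl⟩ := Nat.exists_eq_add_of_le' hn
  rw [readWriteRuns_eq_prod _ _ D.count_U_eq_count_D, hU, Finset.prod_range_succ,
    Finset.prod_range_succ', h0, hlast, Nat.choose_zero_right, add_zero, Nat.choose_self, mul_one,
    mul_one, Nat.add_sub_cancel, Finset.range_eq_Ico, Finset.prod_Ico_add' (fun i =>
      (gapLength .U D.toList i + gapLength .D D.toList i).choose (gapLength .U D.toList i)),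
    zero_add]
  refine Finset.prod_congr (by ext; simp) fun i hi => ?_
  rw [Finset.mem_Ico] at hi
  rw [DyckWord.rStat, DyckWord.sStat, countBetween_eq_gapLength (by simp) _ hi.1 (by omega),
    countBetween_eq_gapLength (by simp) _ hi.1 (by omega)]

theorem DyckWord.sum_readWriteRuns (n : ℕ) :
    ∑ D : {D : DyckWord // D.semilength = n}, readWriteRuns D.1.toList D.1.toList =
      ballotCount 0 n := by
  classical
  have h := sum_queueRuns [] n
  simp only [queueRuns_eq_ite] at h
  rw [← Finset.sum_filter] at h
  refine Eq.trans ?_ h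
  refine Finset.sum_bij (fun D _ => D.1.toList) (fun D _ => ?_) (fun D _ D' _ hDD' => ?_)
    (fun l hl => ?_) (fun _ _ => rfl)
  · rw [Finset.mem_filter, mem_wordsWithCounts]
    exact ⟨⟨D.2, D.1.count_U_eq_count_D ▸ D.2⟩, D.1.count_D_le_count_U⟩
  · exact Subtype.ext (DyckWord.ext hDD')
  · rw [Finset.mem_filter, mem_wordsWithCounts] at hl
    exact ⟨⟨⟨l, hl.1.1.trans hl.1.2.symm, hl.2⟩, hl.1.1⟩, Finset.mem_univ _, rfl⟩

theorem mainTheorem7 (n : ℕ) (hn : 1 ≤ n) :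
    ((∑ D : {D : DyckWord // D.semilength = n},
        ∏ i ∈ Finset.Icc 1 (n - 1),
          (D.1.rStat i + D.1.sStat i).choose (D.1.rStat i) : ℕ) : ℚ) =
      1 / (2 * (n : ℚ) + 1) * ((3 * n).choose n : ℚ) := by
  rw [Finset.sum_congr rfl fun D _ => D.1.prod_choose_eq_readWriteRuns hn D.2,
    DyckWord.sum_readWriteRuns, ← ballotCount_zero_left]
  have : (2 * (n : ℚ) + 1) ≠ 0 := by positivity
  push_cast
  field_simp
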